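/- All simplicial complexes are finite, and the empty set is a face of each of them. The link of a face $\alpha$ of $X$ is $\{\gamma\in X : \gamma\cap\alpha=\emptyset,\ \gamma\cup\alpha\in X\}$. The boundary $\partial X$ of a $D$-dimensional complex $X$ is the subcomplex generated by the $(D-1)$-faces that lie in exactly one $D$-face. Let $\mathbb F$ be a field. An $\mathbb F$-homology $d$-sphere is a complex in which the link of every face $\alpha$ (including $\emptyset$) has the reduced $\mathbb F$-homology of a sphere of dimension $d-\#\alpha$. An $\mathbb F$-homology $(d+1)$-ball is a complex $B$ such that $\partial B$ is an $\mathbb F$-homology $d$-sphere, the link of each face of $\partial B$ (including $\emptyset$) has vanishing reduced $\mathbb F$-homology, and the link of each other face $\alpha$ has the reduced $\mathbb F$-homology of a sphere of dimension $d+1-\#\alpha$. Such a ball is $k$-stacked if all its faces of dimension at most $d-k$ lie in $\partial B$. An $\mathbb F$-homology $d$-sphere $S$ is $k$-stacked if $S=\partial B$ for some $k$-stacked $\mathbb F$-homology $(d+1)$-ball $B$. A complex is a $k$-stellated $d$-sphere if it is obtained from the boundary complex of a $(d+1)$-simplex by finitely many bistellar moves of index $<k$; a bistellar move $\alpha\mapsto\beta$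 of index $\dim\beta$ (with $\alpha,\beta$ nonempty, disjoint, $\dim\alpha+\dim\beta=d$) replaces an induced subcomplex $\overline\alpha*\partial\beta$ by $\partial\alpha*\overline\beta$, where $\overline\alpha$ (resp. $\partial\alpha$) is the complex of all (resp. all proper) subsets of $\alpha$. A $(d+1)$-dimensional pseudomanifold is $k$-shelled if it is obtained from the face complex of a $(d+1)$-simplex by finitely many shelling moves of index $<k$; a shelling move of index $\dim\beta$ from $Y$ to $X\supseteq Y$ (both pure of dimension $d+1$) adds a single facet $\alpha\sqcup\beta$ ($\beta\ne\emptyset$) such that the subcomplex of $Y$ induced on $\alpha\sqcup\beta$ is $\overline\alpha*\partial\beta$. **Theorem.** Let $k\ge 0$ and $d\ge 2k$ be integers, and let $S$ be a $k$-stacked $\mathbb F$-homology $d$-sphere with vertex set $V$. Put $$\overline S=\{\alpha\subseteq V : \text{every subset of } \alpha \text{ of size at most } k+1 \text{ is a face of } S\}.$$ Then $\overline S$ is a $k$-stacked $\mathbb F$-homology $(d+1)$-ball with $\partial\overline S=S$, and it is the only one: if $B$ is a $k$-stacked homology $(d+1)$-ball over any field with $\partial B=S$, then $B=\overline S$. If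 moreover $S$ is $k$-stellated, then $\overline S$ is $k$-shelled. -/

import Mathlib

set_option maxSynthPendingDepth 3

namespace StackedSpheres

/-- A finite abstract simplicial complex with vertices in `V`. As usual in this subject, the empty
set is a face of every simplicial complex. Elements of `V` need not be vertices. -/
@[ext]
structure SimplicialComplex (V : Type*) where
  faces : Set (Finset V)
  finite : faces.Finite
  empty_mem : ∅ ∈ faces
  down_closed : ∀ ⦃σ τ : Finset V⦄, σ ∈ faces → τ ⊆ σ → τ ∈ faces

/-- The vertex set of a simplicial complex. -/
def SimplicialComplex.vertices {V : Type*} (X : SimplicialComplex V) : Set V :=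
  {v | {v} ∈ X.faces}

theorem SimplicialComplex.finite_vertices {V : Type*} (X : SimplicialComplex V) : X.vertices.Finite :=
  X.finite.preimage (f := fun v : V => ({v} : Finset V)) (Finset.singleton_injective.injOn)

section Combinatorics

variable {V : Type*} [DecidableEq V]

/-- The link of a face `α`: all faces `γ` disjoint from `α` such that `γ ∪ α` is a face. -/
def SimplicialComplex.link (X : SimplicialComplex V) (α : Finset V) (hα : α ∈ X.faces) : SimplicialComplex V where
  faces := {γ | γ ∈ X.faces ∧ Disjoint γ α ∧ γ ∪ α ∈ X.faces}
  finite := X.finite.subset fun _ h => h.1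
  empty_mem := ⟨X.empty_mem, Finset.disjoint_empty_left α, by simpa using hα⟩
  down_closed := fun _ _ hσ h =>
    ⟨X.down_closed hσ.1 h, Finset.disjoint_of_subset_left h hσ.2.1,
      X.down_closed hσ.2.2 (Finset.union_subset_union h (Finset.Subset.refl α))⟩

/-- The boundary of a `D`-dimensional weak pseudomanifold `X`: the subcomplex generated by the
`(D-1)`-dimensional faces `ρ` of `X` that are contained in exactly one `D`-dimensional face. -/
def SimplicialComplex.boundary (D : ℕ) (X : SimplicialComplex V) : SimplicialComplex V where
  faces := {γ | γ = ∅ ∨ ∃ ρ ∈ X.faces, γ ⊆ ρ ∧ ρ.card = D ∧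
    ∃! σ, σ ∈ X.faces ∧ ρ ⊆ σ ∧ σ.card = D + 1}
  finite := X.finite.subset <| by
    rintro γ (rfl | ⟨ρ, hρ, h, -⟩)
    · exact X.empty_mem
    · exact X.down_closed hρ h
  empty_mem := Or.inl rfl
  down_closed := by
    rintro σ τ (rfl | ⟨ρ, hρ, h, h'⟩) hτ
    · exact Or.inl (Finset.subset_empty.mp hτ)
    · exact Or.inr ⟨ρ, hρ, hτ.trans h, h'⟩

/-- `X` is a pure simplicial complex of dimension `D`. -/
def SimplicialComplex.IsPure (D : ℕ) (X : SimplicialComplex V) : Prop :=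
  ∀ γ ∈ X.faces, γ.card ≤ D + 1 ∧ ∃ σ ∈ X.faces, γ ⊆ σ ∧ σ.card = D + 1

/-- The dual graph of a pure `D`-dimensional complex: its vertices are the facets, and two facets
are adjacent if they meet in a face of codimension one. -/
def SimplicialComplex.dualGraph (D : ℕ) (X : SimplicialComplex V) :
    SimpleGraph {σ : Finset V // σ ∈ X.faces ∧ σ.card = D + 1} where
  Adj σ τ := σ ≠ τ ∧ (σ.1 ∩ τ.1).card = D
  symm := ⟨fun σ τ h => ⟨h.1.symm, by rw [Finset.inter_comm]; exact h.2⟩⟩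
  loopless := ⟨fun _ h => h.1 rfl⟩

/-- A `D`-dimensional pseudomanifold: pure of dimension `D`, every face of dimension `D - 1` is in
at most two facets, and the dual graph is connected. -/
def SimplicialComplex.IsPseudomanifold (D : ℕ) (X : SimplicialComplex V) : Prop :=
  X.IsPure D ∧
  (∀ ρ ∈ X.faces, ρ.card = D → {σ | σ ∈ X.faces ∧ ρ ⊆ σ ∧ σ.card = D + 1}.ncard ≤ 2) ∧
  (X.dualGraph D).Connected

/-- The faces of the simplex with vertex set `α`, i.e. all subsets of `α`. -/
def simplexFaces (α : Finset V) : Set (Finset V) := {γ | γ ⊆ α}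

/-- The faces of the boundary of the simplex with vertex set `α`, i.e. all proper subsets. -/
def simplexBoundaryFaces (α : Finset V) : Set (Finset V) := {γ | γ ⊂ α}

/-- The faces of a join: the disjoint unions of a face from `K` and a face from `L`. -/
def joinFaces (K L : Set (Finset V)) : Set (Finset V) :=
  {γ | ∃ σ ∈ K, ∃ τ ∈ L, Disjoint σ τ ∧ γ = σ ∪ τ}

/-- `X` is a standard `d`-sphere: the boundary complex of a simplex with `d + 2` vertices. -/
def IsStandardSphere (d : ℕ) (X : SimplicialComplex V) : Prop :=
  ∃ α : Finset V, α.card = d + 2 ∧ X.faces = simplexBoundaryFaces α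

/-- `X` is a standard `D`-ball: the face complex of a simplex with `D + 1` vertices. -/
def IsStandardBall (D : ℕ) (X : SimplicialComplex V) : Prop :=
  ∃ α : Finset V, α.card = D + 1 ∧ X.faces = simplexFaces α

/-- `Y` is obtained from the `d`-dimensional complex `X` by the bistellar move `α ↦ β`: the
subcomplex of `X` induced on `α ∪ β` is the join of the simplex on `α` with the boundary of the
simplex on `β`, and it is replaced by the join of the boundary of `α` with `β`. If `β` is a single
vertex, then it is a new one. -/
def IsBistellarMove (d : ℕ) (X Y : SimplicialComplex V) (α β : Finset V) : Prop :=
  α.Nonempty ∧ β.Nonempty ∧ Disjoint α β ∧ α.card + β.card = d + 2 ∧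
  {γ | γ ∈ X.faces ∧ γ ⊆ α ∪ β} = joinFaces (simplexFaces α) (simplexBoundaryFaces β) ∧
  Y.faces = (X.faces \ joinFaces (simplexFaces α) (simplexBoundaryFaces β)) ∪
    joinFaces (simplexBoundaryFaces α) (simplexFaces β)

/-- `X` is a `k`-stellated complex of dimension `d`: it is obtained from a standard `d`-sphere by a
finite sequence of bistellar moves of index (`= dim β = β.card - 1`) less than `k`. For `k ≤ d`
such moves never delete a vertex, so all complexes of the sequence have their vertices among those
of `X`, and it makes no difference in which type `V` they are taken. -/
def IsStellated (k d : ℕ) (X : SimplicialComplex V) : Prop :=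
  ∃ X₀ : SimplicialComplex V, IsStandardSphere d X₀ ∧
    Relation.ReflTransGen
      (fun Y Z : SimplicialComplex V => ∃ α β : Finset V, β.card ≤ k ∧ IsBistellarMove d Y Z α β) X₀ X

/-- `X` is obtained from `Y` by the shelling move `α ⇝ β`, where `X` and `Y` are pure simplicial
complexes of dimension `D`. -/
def IsShellingMove (D : ℕ) (Y X : SimplicialComplex V) (α β : Finset V) : Prop :=
  X.IsPure D ∧ Y.IsPure D ∧ α ∈ X.faces ∧ β ∈ X.faces ∧ β.Nonempty ∧ Disjoint α β ∧
  Y.faces ⊆ X.faces ∧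
  (∀ σ : Finset V, σ.card = D + 1 → ((σ ∈ X.faces ∧ σ ∉ Y.faces) ↔ σ = α ∪ β)) ∧
  (α ∪ β).card = D + 1 ∧
  {γ | γ ∈ Y.faces ∧ γ ⊆ α ∪ β} = joinFaces (simplexFaces α) (simplexBoundaryFaces β)

/-- `X` is `k`-shelled of dimension `D`: a `D`-dimensional pseudomanifold obtained from a standard
`D`-ball by a finite sequence of shelling moves of index (`= dim β = β.card - 1`) less than `k`. -/
def IsShelled (k D : ℕ) (X : SimplicialComplex V) : Prop :=
  X.IsPseudomanifold D ∧ ∃ X₀ : SimplicialComplex V, IsStandardBall D X₀ ∧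
    Relation.ReflTransGen
      (fun Y Z : SimplicialComplex V => ∃ α β : Finset V, β.card ≤ k ∧ IsShellingMove D Y Z α β) X₀ X

/-- The complex of all sets `α` of vertices of `S` such that all subsets of `α` of size at most
`k + 1` are faces of `S`. -/
def filling (k : ℕ) (S : SimplicialComplex V) : SimplicialComplex V where
  faces := {α | (α : Set V) ⊆ S.vertices ∧ ∀ γ ⊆ α, γ.card ≤ k + 1 → γ ∈ S.faces}
  finite := by
    refine (S.finite_vertices.toFinset.powerset.finite_toSet).subset fun α hα => ?_
    simpa [← Finset.coe_subset] using hα.1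
  empty_mem := ⟨by simp, fun γ hγ _ => by
    rw [Finset.subset_empty.mp hγ]; exact S.empty_mem⟩
  down_closed := fun _ _ hσ h =>
    ⟨(Finset.coe_subset.mpr h).trans hσ.1, fun γ hγ => hσ.2 γ (hγ.trans h)⟩

end Combinatorics

section Homology

variable (F : Type*) [Field F] {V : Type*} [LinearOrder V]

/-- The simplicial boundary operator on formal linear combinations of finite subsets of the
(linearly ordered) set `V`. A set `σ` with vertices `v₀ < v₁ < ⋯` is sent to the sum of
`(-1) ^ i • (σ \ {vᵢ})`; in particular `{v}` is sent to `∅` (augmentation) and `∅` to `0`. -/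
noncomputable def boundaryMap : (Finset V →₀ F) →ₗ[F] (Finset V →₀ F) :=
  Finsupp.linearCombination F fun σ : Finset V =>
    ∑ v ∈ σ, Finsupp.single (σ.erase v) ((-1 : F) ^ (σ.filter (· < v)).card)

/-- The simplicial chains of `X` spanned by the faces with `n` elements (of dimension `n - 1`). -/
noncomputable def chains (X : SimplicialComplex V) (n : ℕ) : Submodule F (Finset V →₀ F) :=
  Finsupp.supported F F {σ | σ ∈ X.faces ∧ σ.card = n}

/-- The cycles among the chains on faces with `n` elements. -/
noncomputable def cycles (X : SimplicialComplex V) (n : ℕ) : Submodule F (Finset V →₀ F) :=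
  chains F X n ⊓ LinearMap.ker (boundaryMap F)

/-- The boundaries among the chains on faces with `n` elements. -/
noncomputable def boundaries (X : SimplicialComplex V) (n : ℕ) : Submodule F (Finset V →₀ F) :=
  (chains F X (n + 1)).map (boundaryMap F)

/-- The reduced simplicial homology of `X` with coefficients in `F`, indexed by the number of
elements of faces: `ReducedHomology F X n` is the reduced homology in degree `n - 1`. -/
abbrev ReducedHomology (X : SimplicialComplex V) (n : ℕ) : Type _ :=
  cycles F X n ⧸ (boundaries F X n).submoduleOf (cycles F X n)

/-- `X` has the reduced `F`-homology of a sphere of dimension `n - 1`. -/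
def HasSphereHomology (X : SimplicialComplex V) (n : ℕ) : Prop :=
  Nonempty (ReducedHomology F X n ≃ₗ[F] F) ∧ ∀ m, m ≠ n → Subsingleton (ReducedHomology F X m)

/-- All the reduced `F`-homology of `X` vanishes. -/
def IsAcyclic (X : SimplicialComplex V) : Prop := ∀ m, Subsingleton (ReducedHomology F X m)

/-- `X` is an `F`-homology `d`-sphere: for every face `α`, including the empty one, the link of
`α` has the reduced `F`-homology of a sphere of dimension `d - #α`. -/
def IsHomologySphere (d : ℕ) (X : SimplicialComplex V) : Prop :=
  ∀ (α : Finset V) (hα : α ∈ X.faces),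
    α.card ≤ d + 1 ∧ HasSphereHomology F (X.link α hα) (d + 1 - α.card)

/-- `X` is an `F`-homology `D`-ball, `D ≥ 1`: its boundary is an `F`-homology `(D-1)`-sphere; the
links of boundary faces (including the empty one, whose link is `X`) are acyclic over `F`; and the
link of an interior face `α` has the reduced `F`-homology of a sphere of dimension `D - #α`. -/
def IsHomologyBall (D : ℕ) (X : SimplicialComplex V) : Prop :=
  1 ≤ D ∧ IsHomologySphere F (D - 1) (X.boundary D) ∧
  ∀ (α : Finset V) (hα : α ∈ X.faces),
    (α ∈ (X.boundary D).faces → IsAcyclic F (X.link α hα)) ∧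
    (α ∉ (X.boundary D).faces →
      α.card ≤ D + 1 ∧ HasSphereHomology F (X.link α hα) (D + 1 - α.card))

/-- `X` is a `k`-stacked `F`-homology `D`-ball: all its faces of codimension at least `k + 1`
(i.e. of dimension at most `D - k - 1`) lie in its boundary. -/
def IsStackedBall (k D : ℕ) (X : SimplicialComplex V) : Prop :=
  IsHomologyBall F D X ∧ ∀ γ ∈ X.faces, γ.card + k ≤ D → γ ∈ (X.boundary D).faces

/-- `S` is a `k`-stacked `F`-homology `d`-sphere: an `F`-homology `d`-sphere that is the boundary
of a `k`-stacked `F`-homology `(d+1)`-ball. -/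
def IsStackedSphere (k d : ℕ) (S : SimplicialComplex V) : Prop :=
  IsHomologySphere F d S ∧ ∃ B : SimplicialComplex V, IsStackedBall F k (d + 1) B ∧ B.boundary (d + 1) = S

end Homology

end StackedSpheres

open StackedSpheres

/-! Let `B` be a `k`-stacked ball with boundary `S`. Since `d ≥ 2k`, faces with at most `k + 1`
elements have codimension large enough to be forced into the boundary, so `B` and `S` agree on sets
of at most `k + 1` elements. It remains to see that `B` has no minimal non-face with more than `k +
1` elements; then `B` is determined by its small faces, hence equals `filling k S`. This gives
existence and uniqueness at once, and uniqueness across fields, because the argument only uses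
homology over the field of the ball in question.

A minimal non-face `α` would make the subcomplex induced on `α` the boundary of a simplex, carrying
a cycle that bounds nothing. Such homology is excluded by `cycles_deletion_le`: faces of large
codimension have acyclic links, and vertices are deleted one at a time by a Mayer–Vietoris argument
(`cycles_deletion_insert_le`), with induction on dimension supplying the deletions of links.

The shelling is purely combinatorial. A bistellar move `α ↦ β` of index less than `k` adds exactly
the simplex `α ∪ β` to the filling (`mem_filling_target_iff`), and this addition is the shelling
move for the same pair. Starting from the standard sphere, whose filling is the full simplex, the
moves thus lift one by one. -/

namespace StackedSpheres

/-! ### Deletions, iterated links and the boundary subcomplex. -/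

section VertexDeletion

/-- The induced subcomplex on the vertices outside `T`. -/
def SimplicialComplex.deletion {V : Type*} (X : SimplicialComplex V) (T : Finset V) :
    SimplicialComplex V where
  faces := {γ | γ ∈ X.faces ∧ Disjoint γ T}
  finite := X.finite.subset fun _ h => h.1
  empty_mem := ⟨X.empty_mem, Finset.disjoint_empty_left T⟩
  down_closed := fun _ _ hσ h => ⟨X.down_closed hσ.1 h, Finset.disjoint_of_subset_left h hσ.2⟩

theorem SimplicialComplex.deletion_empty {V : Type*} (X : SimplicialComplex V) :
    X.deletion ∅ = X := by
  ext γ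
  simp [SimplicialComplex.deletion]

/-- Lets a hypothesis on all links of a complex pass to its vertex links, as needed for induction on
dimension. -/
theorem SimplicialComplex.link_link {V : Type*} [DecidableEq V] (X : SimplicialComplex V)
    {α β : Finset V} (hα : α ∈ X.faces) (hβ : β ∈ (X.link α hα).faces) :
    (X.link α hα).link β hβ = X.link (β ∪ α) hβ.2.2 := by
  ext γ
  constructor
  · rintro ⟨⟨h1, h2, -⟩, h4, -, -, h7⟩
    refine ⟨h1, Finset.disjoint_union_right.mpr ⟨h4, h2⟩, ?_⟩
    rwa [← Finset.union_assoc]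
  · rintro ⟨h1, h2, h3⟩
    rw [Finset.disjoint_union_right] at h2
    rw [← Finset.union_assoc] at h3
    refine ⟨⟨h1, h2.2, X.down_closed h3 ?_⟩, h2.1, X.down_closed h3 Finset.subset_union_left, ?_,
      h3⟩
    · exact Finset.union_subset_union_left Finset.subset_union_left
    · exact Finset.disjoint_union_left.mpr ⟨h2.2, hβ.2.1⟩

theorem SimplicialComplex.link_empty {V : Type*} [DecidableEq V] (X : SimplicialComplex V) :
    X.link ∅ X.empty_mem = X := by
  ext γ
  simp [SimplicialComplex.link]

theorem boundary_faces_subset {V : Type*} [DecidableEq V] (D : ℕ) (B : SimplicialComplex V) :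
    (B.boundary D).faces ⊆ B.faces := by
  rintro γ (rfl | ⟨ρ, hρ, h, -⟩)
  · exact B.empty_mem
  · exact B.down_closed hρ h

end VertexDeletion

/-! ### Chain-level calculus: splitting the boundary operator at a vertex. -/

section Chains

variable (F : Type*) [Field F] {V : Type*}

theorem single_eq_smul_one (σ : Finset V) (a : F) :
    (Finsupp.single σ a : Finset V →₀ F) = a • Finsupp.single σ 1 := by simp

/-- A linear map given on basis elements maps chains into a submodule if it does so for faces. -/
theorem map_mem_of_mem_supported {s : Set (Finset V)} {M : Submodule F (Finset V →₀ F)}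
    (f : (Finset V →₀ F) →ₗ[F] (Finset V →₀ F))
    (hf : ∀ σ ∈ s, f (Finsupp.single σ 1) ∈ M) {w : Finset V →₀ F}
    (hw : w ∈ Finsupp.supported F F s) : f w ∈ M := by
  rw [Finsupp.supported_eq_span_single] at hw
  have : Submodule.span F ((fun i : Finset V => Finsupp.single i (1 : F)) '' s) ≤ M.comap f := by
    rw [Submodule.span_le]
    rintro _ ⟨σ, hσ, rfl⟩
    exact hf σ hσ
  exact this hw

theorem chains_mono {X Y : SimplicialComplex V} (h : X.faces ⊆ Y.faces) (n : ℕ) :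
    chains F X n ≤ chains F Y n :=
  Finsupp.supported_mono fun _ hσ => ⟨h hσ.1, hσ.2⟩

variable [LinearOrder V]

/-- Contraction of chains by a vertex `v`: the part of the boundary obtained by removing `v`. -/
noncomputable def contraction (v : V) : (Finset V →₀ F) →ₗ[F] (Finset V →₀ F) :=
  Finsupp.linearCombination F fun σ : Finset V =>
    if v ∈ σ then Finsupp.single (σ.erase v) ((-1 : F) ^ (σ.filter (· < v)).card) else 0

/-- The projection of chains onto the span of the sets that avoid `v`. -/
noncomputable def avoid (v : V) : (Finset V →₀ F) →ₗ[F] (Finset V →₀ F) :=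
  Finsupp.linearCombination F fun σ : Finset V => if v ∈ σ then 0 else Finsupp.single σ 1

theorem boundaryMap_single (σ : Finset V) :
    boundaryMap F (Finsupp.single σ 1) =
      ∑ v ∈ σ, Finsupp.single (σ.erase v) ((-1 : F) ^ (σ.filter (· < v)).card) := by
  simp [boundaryMap]

theorem contraction_single (v : V) (σ : Finset V) :
    contraction F v (Finsupp.single σ 1) =
      if v ∈ σ then Finsupp.single (σ.erase v) ((-1 : F) ^ (σ.filter (· < v)).card) else 0 := by
  simp [contraction]

theorem avoid_single (v : V) (σ : Finset V) :
    avoid F v (Finsupp.single σ 1) = if v ∈ σ then 0 else Finsupp.single σ 1 := by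
  simp [avoid]

theorem avoid_apply_of_notMem {v : V} {τ : Finset V} (h : v ∉ τ) (w : Finset V →₀ F) :
    avoid F v w τ = w τ := by
  have : (Finsupp.lapply τ).comp (avoid F v) = (Finsupp.lapply τ : (Finset V →₀ F) →ₗ[F] F) := by
    refine Finsupp.lhom_ext' fun σ => LinearMap.ext_ring ?_
    simp only [LinearMap.comp_apply, Finsupp.lsingle_apply, Finsupp.lapply_apply, avoid_single]
    split_ifs with hv
    · have : σ ≠ τ := by rintro rfl; exact h hv
      simp [Finsupp.single_eq_of_ne' this]
    · rfl
  exact LinearMap.congr_fun this w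

/-- A term of the boundary avoids `v` either because the face already did, or because `v` is the
vertex just removed. This replaces the Mayer–Vietoris decomposition at `v`. -/
theorem avoid_boundaryMap (v : V) (w : Finset V →₀ F) :
    avoid F v (boundaryMap F w) = boundaryMap F (avoid F v w) + contraction F v w := by
  have : (avoid F v).comp (boundaryMap F) =
      (boundaryMap F).comp (avoid F v) + contraction F v := by
    refine Finsupp.lhom_ext' fun σ => LinearMap.ext_ring ?_
    simp only [LinearMap.comp_apply, LinearMap.add_apply, Finsupp.lsingle_apply,
      boundaryMap_single, contraction_single, avoid_single, map_sum]
    by_cases hv : v ∈ σ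
    · rw [if_pos hv, if_pos hv, map_zero, zero_add, Finset.sum_eq_single v]
      · rw [single_eq_smul_one, map_smul, avoid_single]; simp
      · intro u _ hu
        rw [single_eq_smul_one, map_smul, avoid_single]
        simp [hv, hu.symm]
      · exact fun h => absurd hv h
    · rw [if_neg hv, if_neg hv, add_zero, boundaryMap_single]
      refine Finset.sum_congr rfl fun u _ => ?_
      rw [single_eq_smul_one, map_smul, avoid_single]
      simp [hv]
  exact LinearMap.congr_fun this w

/-- For `u < v`, removing `u` lowers the position of `v` by one, while removing `v` leaves that of
`u` unchanged. -/
theorem sign_erase {σ : Finset V} {u v : V} (hu : u ∈ σ) (hv : v ∈ σ) (huv : u ≠ v) :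
    (-1 : F) ^ (σ.filter (· < u)).card * (-1) ^ ((σ.erase u).filter (· < v)).card =
      -((-1 : F) ^ (σ.filter (· < v)).card * (-1) ^ ((σ.erase v).filter (· < u)).card) := by
  wlog h : u < v generalizing u v
  · rw [this hv hu huv.symm (lt_of_le_of_ne (not_lt.mp h) huv.symm), neg_neg]
  have h1 : ((σ.erase u).filter (· < v)).card + 1 = (σ.filter (· < v)).card := by
    rw [Finset.filter_erase]
    exact Finset.card_erase_add_one (Finset.mem_filter.mpr ⟨hu, h⟩)
  have h2 : (σ.erase v).filter (· < u) = σ.filter (· < u) := by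
    rw [Finset.filter_erase]
    exact Finset.erase_eq_of_notMem fun hmem => absurd (Finset.mem_filter.mp hmem).2 h.not_gt
  rw [h2, ← h1, pow_succ]
  ring

/-- Removing two vertices in either order gives opposite signs. Consequently contraction carries
cycles to cycles of the link. -/
theorem contraction_boundaryMap (v : V) (w : Finset V →₀ F) :
    contraction F v (boundaryMap F w) = -boundaryMap F (contraction F v w) := by
  have : (contraction F v).comp (boundaryMap F) =
      -(boundaryMap F).comp (contraction F v) := by
    refine Finsupp.lhom_ext' fun σ => LinearMap.ext_ring ?_
    simp only [LinearMap.comp_apply, LinearMap.neg_apply, Finsupp.lsingle_apply,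
      boundaryMap_single, contraction_single, map_sum]
    by_cases hv : v ∈ σ
    · rw [if_pos hv, single_eq_smul_one, map_smul, boundaryMap_single, ← Finset.sum_erase_add _ _ hv,
        Finset.smul_sum, ← Finset.sum_neg_distrib]
      have h0 : contraction F v (Finsupp.single (σ.erase v)
          ((-1 : F) ^ (σ.filter (· < v)).card)) = 0 := by
        rw [single_eq_smul_one, map_smul, contraction_single]; simp
      rw [h0, add_zero]
      refine Finset.sum_congr rfl fun u hu => ?_
      rw [Finset.mem_erase] at hu
      rw [single_eq_smul_one, map_smul, contraction_single, if_pos (by simp [hv, hu.1.symm]),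
        Finsupp.smul_single, Finsupp.smul_single, smul_eq_mul, smul_eq_mul,
        sign_erase F hu.2 hv hu.1, Finset.erase_right_comm, Finsupp.single_neg]
    · rw [if_neg hv, map_zero, neg_zero]
      refine Finset.sum_eq_zero fun u _ => ?_
      rw [single_eq_smul_one, map_smul, contraction_single]
      simp [hv]
  exact LinearMap.congr_fun this w

theorem boundaryMap_mem_supported {s t : Set (Finset V)}
    (h : ∀ σ ∈ s, ∀ v ∈ σ, σ.erase v ∈ t) {w : Finset V →₀ F}
    (hw : w ∈ Finsupp.supported F F s) : boundaryMap F w ∈ Finsupp.supported F F t := by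
  refine map_mem_of_mem_supported F _ (fun σ hσ => ?_) hw
  rw [boundaryMap_single]
  exact Submodule.sum_mem _ fun v hv => Finsupp.single_mem_supported F _ (h σ hσ v hv)

theorem contraction_mem_supported {s t : Set (Finset V)} {v : V}
    (h : ∀ σ ∈ s, v ∈ σ → σ.erase v ∈ t) {w : Finset V →₀ F}
    (hw : w ∈ Finsupp.supported F F s) : contraction F v w ∈ Finsupp.supported F F t := by
  refine map_mem_of_mem_supported F _ (fun σ hσ => ?_) hw
  rw [contraction_single]
  split_ifs with hv
  · exact Finsupp.single_mem_supported F _ (h σ hσ hv)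
  · exact Submodule.zero_mem _

theorem avoid_mem_supported {s t : Set (Finset V)} {v : V}
    (h : ∀ σ ∈ s, v ∉ σ → σ ∈ t) {w : Finset V →₀ F}
    (hw : w ∈ Finsupp.supported F F s) : avoid F v w ∈ Finsupp.supported F F t := by
  refine map_mem_of_mem_supported F _ (fun σ hσ => ?_) hw
  rw [avoid_single]
  split_ifs with hv
  · exact Submodule.zero_mem _
  · exact Finsupp.single_mem_supported F _ (h σ hσ hv)

theorem avoid_eq_self {s : Set (Finset V)} {v : V} (h : ∀ σ ∈ s, v ∉ σ) {w : Finset V →₀ F}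
    (hw : w ∈ Finsupp.supported F F s) : avoid F v w = w := by
  rw [← sub_eq_zero, ← Submodule.mem_bot F]
  refine map_mem_of_mem_supported F (avoid F v - LinearMap.id) (fun σ hσ => ?_) hw
  simp [avoid_single, h σ hσ]

theorem contraction_eq_zero {s : Set (Finset V)} {v : V} (h : ∀ σ ∈ s, v ∉ σ) {w : Finset V →₀ F}
    (hw : w ∈ Finsupp.supported F F s) : contraction F v w = 0 := by
  rw [← Submodule.mem_bot F]
  refine map_mem_of_mem_supported F _ (fun σ hσ => ?_) hw
  simp [contraction_single, h σ hσ]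

/-- No double sum is needed: the coefficient at a proper subset `τ` is read off after projecting
away from some `v ∈ σ \ τ`, where the two commutation rules leave two cancelling terms. -/
theorem boundaryMap_boundaryMap_single (σ : Finset V) :
    boundaryMap F (boundaryMap F (Finsupp.single σ 1)) = 0 := by
  have hsupp : boundaryMap F (boundaryMap F (Finsupp.single σ 1)) ∈
      Finsupp.supported F F {τ : Finset V | τ ⊂ σ} := by
    refine boundaryMap_mem_supported F (s := {τ | τ ⊆ σ}) (fun τ hτ v hv => ?_)
      (boundaryMap_mem_supported F (s := {σ}) ?_ (Finsupp.single_mem_supported F _ rfl))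
    · exact (Finset.erase_ssubset hv).trans_subset hτ
    · rintro _ rfl v _
      exact Finset.erase_subset v _
  ext τ
  by_cases hτ : τ ⊂ σ
  · obtain ⟨v, hv, hvτ⟩ := Finset.exists_of_ssubset hτ
    have hzero : avoid F v (Finsupp.single σ 1) = 0 := by rw [avoid_single, if_pos hv]
    rw [← avoid_apply_of_notMem F hvτ, avoid_boundaryMap, avoid_boundaryMap, hzero, map_zero,
      zero_add, contraction_boundaryMap, add_neg_cancel]
  · exact (Finsupp.mem_supported' F _).mp hsupp τ hτ

theorem boundaryMap_single_ne_zero {σ : Finset V} (hσ : σ.Nonempty) :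
    boundaryMap F (Finsupp.single σ 1) ≠ 0 := by
  obtain ⟨v, hv⟩ := hσ
  intro h
  have h1 := avoid_boundaryMap F v (Finsupp.single σ 1)
  rw [h, map_zero, avoid_single, if_pos hv, map_zero, zero_add, contraction_single, if_pos hv,
    eq_comm, Finsupp.single_eq_zero] at h1
  exact pow_ne_zero _ (neg_ne_zero.mpr one_ne_zero) h1

theorem subsingleton_reducedHomology_iff (X : SimplicialComplex V) (n : ℕ) :
    Subsingleton (ReducedHomology F X n) ↔ cycles F X n ≤ boundaries F X n := by
  exact Submodule.Quotient.subsingleton_iff.trans Submodule.submoduleOf_eq_top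

end Chains

/-! ### Vanishing homology of induced subcomplexes and the absence of large missing faces. -/

section MissingFaces

variable {F : Type*} [Field F] {V : Type*} [LinearOrder V]

/-- Deleting a further vertex does not create homology in degree `n`, provided that the
corresponding deletion of the link of the vertex has none. -/
theorem cycles_deletion_insert_le {X : SimplicialComplex V} {T : Finset V} {v : V} {n : ℕ}
    (hv : {v} ∈ X.faces)
    (hX : cycles F (X.deletion T) n ≤ boundaries F (X.deletion T) n)
    (hL : cycles F ((X.link {v} hv).deletion T) n ≤
      boundaries F ((X.link {v} hv).deletion T) n) :
    cycles F (X.deletion (insert v T)) n ≤ boundaries F (X.deletion (insert v T)) n := by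
  rintro z ⟨hz, hz0⟩
  have hsub : (X.deletion (insert v T)).faces ⊆ (X.deletion T).faces := fun γ hγ =>
    ⟨hγ.1, Finset.disjoint_of_subset_right (Finset.subset_insert v T) hγ.2⟩
  have hvz : ∀ σ ∈ {σ | σ ∈ (X.deletion (insert v T)).faces ∧ σ.card = n}, v ∉ σ :=
    fun σ hσ hvσ => Finset.disjoint_left.mp hσ.1.2 hvσ (Finset.mem_insert_self v T)
  obtain ⟨w, hw, rfl⟩ := hX ⟨chains_mono F hsub n hz, hz0⟩
  -- The filling chain `w` may pass through `v`; its part there contracts to a chain in the link, a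
  -- cycle because `∂w` avoids `v`.
  have hu : contraction F v w ∈ cycles F ((X.link {v} hv).deletion T) n := by
    refine ⟨contraction_mem_supported F (fun σ hσ hvσ => ?_) hw, ?_⟩
    · refine ⟨⟨⟨X.down_closed hσ.1.1 (Finset.erase_subset v σ), by simp, ?_⟩,
        Finset.disjoint_of_subset_left (Finset.erase_subset v σ) hσ.1.2⟩, ?_⟩
      · rw [Finset.union_comm, ← Finset.insert_eq, Finset.insert_erase hvσ]
        exact hσ.1.1
      · rw [Finset.card_erase_of_mem hvσ, hσ.2, Nat.add_sub_cancel]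
    · change boundaryMap F _ = 0
      rw [← neg_eq_zero, ← contraction_boundaryMap]
      exact contraction_eq_zero F hvz hz
  obtain ⟨y, hy, hyu⟩ := hL hu
  -- Cut the part of `w` through `v` out and patch the hole with `y`, which bounds it inside the
  -- link.
  refine ⟨avoid F v w + y, Submodule.add_mem _ ?_ ?_, ?_⟩
  · refine avoid_mem_supported F (fun σ hσ hvσ => ?_) hw
    exact ⟨⟨hσ.1.1, Finset.disjoint_insert_right.mpr ⟨hvσ, hσ.1.2⟩⟩, hσ.2⟩
  · refine chains_mono F ?_ (n + 1) hy
    rintro γ ⟨⟨h1, h2, -⟩, h3⟩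
    exact ⟨h1, Finset.disjoint_insert_right.mpr ⟨Finset.disjoint_singleton_right.mp h2, h3⟩⟩
  · rw [map_add, hyu, ← avoid_boundaryMap]
    exact avoid_eq_self F hvz hz

/-- If the links of all faces of large codimension have no homology in high degrees, then neither
has any induced subcomplex. -/
theorem cycles_deletion_le {k : ℕ} (E : ℕ) {X : SimplicialComplex V}
    (hE : ∀ γ ∈ X.faces, γ.card ≤ E)
    (hX : ∀ (α : Finset V) (hα : α ∈ X.faces), α.card + k + 1 ≤ E → ∀ n, k + 1 ≤ n →
      cycles F (X.link α hα) n ≤ boundaries F (X.link α hα) n)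
    (T : Finset V) {n : ℕ} (hn : k + 1 ≤ n) :
    cycles F (X.deletion T) n ≤ boundaries F (X.deletion T) n := by
  -- `E` bounds the sizes of faces and drops by one in a vertex link, so the codimension condition
  -- on faces is inherited. Once `E ≤ k`, no face has `n ≥ k + 1` elements and the claim is empty.
  induction E generalizing X T with
  | zero =>
    rintro z ⟨hz, -⟩
    have : z = 0 := by
      ext σ
      refine (Finsupp.mem_supported' F _).mp hz σ fun hσ => ?_
      have := hE σ hσ.1.1
      have := hσ.2
      omega
    rw [this]
    exact Submodule.zero_mem _
  | succ E ih =>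
    by_cases hkE : k + 1 ≤ E + 1
    · induction T using Finset.induction_on with
      | empty =>
        have := hX ∅ X.empty_mem (by simpa using hkE) n hn
        rwa [X.link_empty, ← X.deletion_empty] at this
      | insert v T _ ihT =>
        by_cases hv : {v} ∈ X.faces
        · refine cycles_deletion_insert_le hv ihT (ih ?_ ?_ T)
          · rintro γ ⟨-, h2, h3⟩
            have := hE _ h3
            rw [Finset.card_union_of_disjoint h2, Finset.card_singleton] at this
            omega
          · intro α hα hαE m hm
            rw [X.link_link hv hα]
            refine hX _ _ ?_ m hm
            rw [Finset.card_union_of_disjoint hα.2.1, Finset.card_singleton]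
            omega
        · have : X.deletion (insert v T) = X.deletion T := by
            ext γ
            refine and_congr_right fun hγ => ?_
            rw [Finset.disjoint_insert_right, and_iff_right_iff_imp]
            exact fun _ hvγ => hv (X.down_closed hγ (Finset.singleton_subset_iff.mpr hvγ))
          rwa [this]
    · rintro z ⟨hz, -⟩
      have : z = 0 := by
        ext σ
        refine (Finsupp.mem_supported' F _).mp hz σ fun hσ => ?_
        have := hE σ hσ.1.1
        have := hσ.2
        omega
      rw [this]
      exact Submodule.zero_mem _

/-- If no induced subcomplex has homology in degrees `k` and higher, then a set of vertices all of
whose subsets with at most `k + 1` elements are faces is a face. -/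
theorem mem_faces_of_forall_small {k : ℕ} {X : SimplicialComplex V}
    (hX : ∀ (T : Finset V) (n : ℕ), k + 1 ≤ n →
      cycles F (X.deletion T) n ≤ boundaries F (X.deletion T) n)
    (α : Finset V) (hα : ∀ γ ⊆ α, γ.card ≤ k + 1 → γ ∈ X.faces) : α ∈ X.faces := by
  induction α using Finset.strongInduction with
  | H α ih =>
    by_contra hαX
    have hproper : ∀ γ ⊂ α, γ ∈ X.faces := fun γ hγ =>
      ih γ hγ fun δ hδ => hα δ (hδ.trans hγ.subset)
    have hcard : k + 1 < α.card := by
      by_contra h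
      exact hαX (hα α Finset.Subset.rfl (not_lt.mp h))
    -- Deleting all vertices outside the minimal non-face `α` leaves exactly the boundary of the
    -- simplex on `α`.
    set T := X.finite_vertices.toFinset \ α with hT
    have hdel : ∀ γ ∈ (X.deletion T).faces, γ ⊆ α := by
      rintro γ ⟨h1, h2⟩ v hv
      by_contra hvα
      refine Finset.disjoint_left.mp h2 hv (Finset.mem_sdiff.mpr ⟨?_, hvα⟩)
      rw [Set.Finite.mem_toFinset]
      exact X.down_closed h1 (Finset.singleton_subset_iff.mpr hv)
    have hz : boundaryMap F (Finsupp.single α 1) ∈ cycles F (X.deletion T) (α.card - 1) := by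
      refine ⟨boundaryMap_mem_supported F (s := {α}) ?_ (Finsupp.single_mem_supported F _ rfl),
        boundaryMap_boundaryMap_single F α⟩
      rintro _ rfl v hv
      refine ⟨⟨hproper _ (Finset.erase_ssubset hv), ?_⟩, Finset.card_erase_of_mem hv⟩
      exact Finset.disjoint_of_subset_left (Finset.erase_subset v _) Finset.disjoint_sdiff
    obtain ⟨w, hw, hwz⟩ := hX T (α.card - 1) (by omega) hz
    -- A face of the deletion with `α.card` elements would have to be `α` itself, so there are no
    -- chains to bound with.
    have hw0 : w = 0 := by
      ext σ
      refine (Finsupp.mem_supported' F _).mp hw σ fun hσ => hαX ?_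
      have : σ = α := Finset.eq_of_subset_of_card_le (hdel σ hσ.1) (by have := hσ.2; omega)
      exact this ▸ hσ.1.1
    rw [hw0, map_zero] at hwz
    exact boundaryMap_single_ne_zero F (Finset.card_pos.mp (by omega)) hwz.symm

theorem IsHomologyBall.card_le {D : ℕ} {B : SimplicialComplex V} (hB : IsHomologyBall F D B)
    {γ : Finset V} (hγ : γ ∈ B.faces) : γ.card ≤ D + 1 := by
  by_cases h : γ ∈ (B.boundary D).faces
  · obtain rfl | ⟨ρ, -, hγρ, hρ, -⟩ := h
    · simp
    · have := Finset.card_le_card hγρ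
      omega
  · exact ((hB.2.2 γ hγ).2 h).1

/-- A `k`-stacked ball of dimension greater than `2k` is the filling of its boundary. -/
theorem IsStackedBall.eq_filling {k d : ℕ} (hd : 2 * k ≤ d) {B : SimplicialComplex V}
    (hB : IsStackedBall F k (d + 1) B) : B = filling k (B.boundary (d + 1)) := by
  -- With `E = d + 2`, the largest possible face size, the codimension condition is precisely the
  -- one under which stackedness puts `α` in the boundary and makes its link acyclic.
  have hX := fun (T : Finset V) (n : ℕ) (hn : k + 1 ≤ n) =>
    cycles_deletion_le (F := F) (k := k) (d + 2) (fun γ hγ => hB.1.card_le hγ)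
      (fun α hα hαd m _ => (subsingleton_reducedHomology_iff F _ m).mp
        ((hB.1.2.2 α hα).1 (hB.2 α hα (by omega)) m)) T hn
  ext α
  constructor
  · intro hα
    refine ⟨fun v hv => ?_, fun γ hγ hγk => hB.2 γ (B.down_closed hα hγ) (by omega)⟩
    refine hB.2 {v} (B.down_closed hα (Finset.singleton_subset_iff.mpr hv)) ?_
    rw [Finset.card_singleton]
    omega
  · exact fun hα => mem_faces_of_forall_small hX α fun γ hγ hγk =>
      boundary_faces_subset (d + 1) B (hα.2 γ hγ hγk)

end MissingFaces

end StackedSpheres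

namespace StackedSpheres

/-! ### Fillings and joins, without homology. -/

section Combinatorics

variable {V : Type*}

/-- The condition on vertices is redundant because singletons have at most `k + 1` elements. -/
theorem mem_filling_iff {k : ℕ} {S : SimplicialComplex V} {α : Finset V} :
    α ∈ (filling k S).faces ↔ ∀ γ ⊆ α, γ.card ≤ k + 1 → γ ∈ S.faces := by
  refine ⟨fun h => h.2, fun h => ⟨fun v hv => ?_, h⟩⟩
  exact h {v} (Finset.singleton_subset_iff.mpr hv) (by simp)

theorem faces_subset_filling (k : ℕ) (S : SimplicialComplex V) :
    S.faces ⊆ (filling k S).faces := fun _ hα =>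
  mem_filling_iff.mpr fun _ hγ _ => S.down_closed hα hγ

variable [DecidableEq V]

theorem joinFaces_comm (K L : Set (Finset V)) : joinFaces K L = joinFaces L K := by
  ext γ
  constructor
  · rintro ⟨σ, hσ, τ, hτ, h, rfl⟩
    exact ⟨τ, hτ, σ, hσ, h.symm, Finset.union_comm σ τ⟩
  · rintro ⟨σ, hσ, τ, hτ, h, rfl⟩
    exact ⟨τ, hτ, σ, hσ, h.symm, Finset.union_comm σ τ⟩

theorem mem_joinFaces_simplex_boundary {α β : Finset V} (h : Disjoint α β) {γ : Finset V} :
    γ ∈ joinFaces (simplexFaces α) (simplexBoundaryFaces β) ↔ γ ⊆ α ∪ β ∧ ¬β ⊆ γ := by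
  constructor
  · rintro ⟨σ, hσ, τ, hτ, -, rfl⟩
    have hτβ : τ ⊂ β := hτ
    refine ⟨Finset.union_subset_union hσ hτβ.1, fun hβ => hτβ.2 fun v hv => ?_⟩
    exact (Finset.mem_union.mp (hβ hv)).resolve_left fun hvσ =>
      Finset.disjoint_left.mp h (hσ hvσ) hv
  · rintro ⟨h1, h2⟩
    refine ⟨γ ∩ α, Finset.inter_subset_right, γ ∩ β,
      ⟨Finset.inter_subset_right, fun hβ => h2 (hβ.trans Finset.inter_subset_left)⟩,
      Finset.disjoint_of_subset_left Finset.inter_subset_right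
        (Finset.disjoint_of_subset_right Finset.inter_subset_right h), ?_⟩
    rw [← Finset.inter_union_distrib_left, Finset.inter_eq_left.mpr h1]

theorem mem_joinFaces_boundary_simplex {α β : Finset V} (h : Disjoint α β) {γ : Finset V} :
    γ ∈ joinFaces (simplexBoundaryFaces α) (simplexFaces β) ↔ γ ⊆ α ∪ β ∧ ¬α ⊆ γ := by
  rw [joinFaces_comm, mem_joinFaces_simplex_boundary h.symm, Finset.union_comm]

/-! ### Effect of a bistellar move of small index on the filling. -/

namespace IsBistellarMove

variable {d k : ℕ} {X Y : SimplicialComplex V} {α β : Finset V}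

theorem mem_source_iff (h : IsBistellarMove d X Y α β) {γ : Finset V} (hγ : γ ⊆ α ∪ β) :
    γ ∈ X.faces ↔ ¬β ⊆ γ := by
  obtain ⟨-, -, hdisj, -, hind, -⟩ := h
  have := Set.ext_iff.mp hind γ
  rw [mem_joinFaces_simplex_boundary hdisj] at this
  simpa [hγ] using this

theorem mem_target_iff (h : IsBistellarMove d X Y α β) {γ : Finset V} :
    γ ∈ Y.faces ↔ (γ ∈ X.faces ∧ ¬γ ⊆ α ∪ β) ∨ (γ ⊆ α ∪ β ∧ ¬α ⊆ γ) := by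
  have hsource := h.mem_source_iff (γ := γ)
  obtain ⟨-, -, hdisj, -, -, hY⟩ := h
  rw [hY, Set.mem_union, Set.mem_sdiff, mem_joinFaces_simplex_boundary hdisj,
    mem_joinFaces_boundary_simplex hdisj]
  tauto

theorem notMem_source (h : IsBistellarMove d X Y α β) : β ∉ X.faces := fun hβ =>
  (h.mem_source_iff Finset.subset_union_right).mp hβ Finset.Subset.rfl

theorem mem_target (h : IsBistellarMove d X Y α β) {γ : Finset V} (hγ : γ ∈ X.faces)
    (hα : γ.card < α.card) : γ ∈ Y.faces := by
  rw [h.mem_target_iff]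
  have : ¬α ⊆ γ := fun h' => (Finset.card_le_card h').not_gt hα
  tauto

theorem mem_target_of_subset (h : IsBistellarMove d X Y α β) {γ : Finset V} (hγ : γ ⊆ α ∪ β)
    (hα : γ.card < α.card) : γ ∈ Y.faces :=
  h.mem_target_iff.mpr (Or.inr ⟨hγ, fun h' => (Finset.card_le_card h').not_gt hα⟩)

theorem card_union (h : IsBistellarMove d X Y α β) : (α ∪ β).card = d + 1 + 1 := by
  rw [Finset.card_union_of_disjoint h.2.2.1, h.2.2.2.1]

/-- A bistellar move of small index changes the filling by adding a single simplex. -/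
theorem mem_filling_target_iff (h : IsBistellarMove d X Y α β) (hd : 2 * k ≤ d)
    (hβ : β.card ≤ k) {γ : Finset V} :
    γ ∈ (filling k Y).faces ↔ γ ∈ (filling k X).faces ∨ γ ⊆ α ∪ β := by
  have hcard := h.2.2.2.1
  constructor
  · intro hγ
    by_cases hβγ : β ⊆ γ
    · refine Or.inr fun v hv => ?_
      by_contra hvZ
      -- This set has at most `k + 1` elements, but no face of `Y` containing `β` leaves `α ∪ β`.
      have hmem : insert v β ∈ Y.faces :=
        hγ.2 _ (Finset.insert_subset hv hβγ) ((Finset.card_insert_le v β).trans (by omega))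
      rcases h.mem_target_iff.mp hmem with h' | h'
      · exact h.notMem_source (X.down_closed h'.1 (Finset.subset_insert v β))
      · exact hvZ (h'.1 (Finset.mem_insert_self v β))
    · refine Or.inl (mem_filling_iff.mpr fun δ hδ hδk => ?_)
      rcases h.mem_target_iff.mp (hγ.2 δ hδ hδk) with h' | h'
      · exact h'.1
      · exact (h.mem_source_iff h'.1).mpr fun hβδ => hβγ (hβδ.trans hδ)
  · rintro (hγ | hγ)
    -- Here `α.card ≥ d + 2 - k ≥ k + 2`, so no small set contains `α` and no small face is
    -- destroyed.
    · exact mem_filling_iff.mpr fun δ hδ hδk => h.mem_target (hγ.2 δ hδ hδk) (by omega)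
    · exact mem_filling_iff.mpr fun δ hδ hδk =>
        h.mem_target_of_subset (hδ.trans hγ) (by omega)

theorem notMem_filling_source (h : IsBistellarMove d X Y α β) (hβ : β.card ≤ k) {γ : Finset V}
    (hγ : β ⊆ γ) : γ ∉ (filling k X).faces := fun h' =>
  h.notMem_source (h'.2 β hγ (by omega))

/-- The facets of the filling containing a given face, after the move. -/
theorem ncard_facets_le (h : IsBistellarMove d X Y α β) (hd : 2 * k ≤ d) (hβ : β.card ≤ k)
    (ρ : Finset V) :
    {σ | σ ∈ (filling k Y).faces ∧ ρ ⊆ σ ∧ σ.card = d + 1 + 1}.ncard ≤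
      {σ | σ ∈ (filling k X).faces ∧ ρ ⊆ σ ∧ σ.card = d + 1 + 1}.ncard +
        if ρ ⊆ α ∪ β then 1 else 0 := by
  have hfin : {σ | σ ∈ (filling k X).faces ∧ ρ ⊆ σ ∧ σ.card = d + 1 + 1}.Finite :=
    (filling k X).finite.subset fun _ hσ => hσ.1
  have hfacet : ∀ σ, σ ⊆ α ∪ β → σ.card = d + 1 + 1 → σ = α ∪ β := fun σ h1 h2 =>
    Finset.eq_of_subset_of_card_le h1 (by rw [h2, h.card_union])
  split_ifs with hρ
  · refine le_trans (Set.ncard_le_ncard (fun σ hσ => ?_) (hfin.insert (α ∪ β)))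
      (Set.ncard_insert_le (α ∪ β) _)
    rcases (h.mem_filling_target_iff hd hβ).mp hσ.1 with h' | h'
    · exact Or.inr ⟨h', hσ.2⟩
    · exact Or.inl (hfacet σ h' hσ.2.2)
  · refine Set.ncard_le_ncard (fun σ hσ => ?_) hfin
    rcases (h.mem_filling_target_iff hd hβ).mp hσ.1 with h' | h'
    · exact ⟨h', hσ.2⟩
    · exact absurd (hσ.2.1.trans h') hρ

end IsBistellarMove

/-! ### Lifting bistellar moves to shelling moves. -/

/-- The properties of a sphere `S` and its filling that persist under bistellar moves of small
index. -/
structure HasShelledFilling (k d : ℕ) (S : SimplicialComplex V) : Prop where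
  mem_of_card : ∀ γ ∈ (filling k S).faces, γ.card + k ≤ d + 1 → γ ∈ S.faces
  isPure : (filling k S).IsPure (d + 1)
  ridge : ∀ ρ ∈ (filling k S).faces, ρ.card = d + 1 →
    {σ | σ ∈ (filling k S).faces ∧ ρ ⊆ σ ∧ σ.card = d + 1 + 1}.ncard ≤ 2
  boundary_ridge : ∀ ρ ∈ S.faces, ρ.card = d + 1 →
    {σ | σ ∈ (filling k S).faces ∧ ρ ⊆ σ ∧ σ.card = d + 1 + 1}.ncard ≤ 1
  connected : ((filling k S).dualGraph (d + 1)).Connected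
  shelling : ∃ X₀ : SimplicialComplex V, IsStandardBall (d + 1) X₀ ∧
    Relation.ReflTransGen (fun Y Z : SimplicialComplex V =>
      ∃ α β : Finset V, β.card ≤ k ∧ IsShellingMove (d + 1) Y Z α β) X₀ (filling k S)

theorem IsStandardSphere.hasShelledFilling {k d : ℕ} (hd : 2 * k ≤ d) {S : SimplicialComplex V}
    (hS : IsStandardSphere d S) : HasShelledFilling k d S := by
  obtain ⟨α, hα, hfaces⟩ := hS
  have hmem : ∀ γ, γ ∈ S.faces ↔ γ ⊂ α := fun γ => by rw [hfaces]; rfl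
  have hfill : ∀ γ, γ ∈ (filling k S).faces ↔ γ ⊆ α := by
    refine fun γ => ⟨fun hγ v hv => ?_, fun hγ => mem_filling_iff.mpr fun δ hδ hδk => ?_⟩
    · exact Finset.singleton_subset_iff.mp ((hmem {v}).mp (hγ.1 hv)).subset
    · rw [hmem, Finset.ssubset_iff_subset_ne]
      refine ⟨hδ.trans hγ, ?_⟩
      rintro rfl
      omega
  have hfacet : ∀ σ, σ ∈ (filling k S).faces → σ.card = d + 1 + 1 → σ = α := fun σ h1 h2 =>
    Finset.eq_of_subset_of_card_le ((hfill σ).mp h1) (by omega)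
  have hone : ∀ ρ : Finset V,
      {σ | σ ∈ (filling k S).faces ∧ ρ ⊆ σ ∧ σ.card = d + 1 + 1}.ncard ≤ 1 := fun ρ =>
    (Set.ncard_le_ncard (t := {α}) (fun σ hσ => hfacet σ hσ.1 hσ.2.2)).trans_eq
      (Set.ncard_singleton α)
  refine ⟨fun γ hγ hγd => ?_, fun γ hγ => ⟨?_, α, (hfill α).mpr Finset.Subset.rfl,
    (hfill γ).mp hγ, hα⟩, fun ρ _ _ => (hone ρ).trans one_le_two, fun ρ _ _ => hone ρ, ?_,
    filling k S, ⟨α, hα, Set.ext hfill⟩, Relation.ReflTransGen.refl⟩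
  · rw [hmem, Finset.ssubset_iff_subset_ne]
    refine ⟨(hfill γ).mp hγ, ?_⟩
    rintro rfl
    omega
  · exact (Finset.card_le_card ((hfill γ).mp hγ)).trans_eq hα
  · have : Nonempty {σ : Finset V // σ ∈ (filling k S).faces ∧ σ.card = d + 1 + 1} :=
      ⟨⟨α, (hfill α).mpr Finset.Subset.rfl, hα⟩⟩
    refine ⟨fun σ τ => ?_⟩
    have : σ = τ := Subtype.ext
      ((hfacet σ σ.2.1 σ.2.2).trans (hfacet τ τ.2.1 τ.2.2).symm)
    rw [this]

theorem HasShelledFilling.bistellarMove {k d : ℕ} (hd : 2 * k ≤ d) {X Y : SimplicialComplex V}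
    {α β : Finset V} (hX : HasShelledFilling k d X) (hβ : β.card ≤ k)
    (h : IsBistellarMove d X Y α β) : HasShelledFilling k d Y := by
  have hcard := h.2.2.2.1
  have hcardZ := h.card_union
  have hfill : ∀ γ, γ ∈ (filling k Y).faces ↔ γ ∈ (filling k X).faces ∨ γ ⊆ α ∪ β :=
    fun γ => h.mem_filling_target_iff hd hβ
  have hsub : ∀ γ, γ ∈ (filling k X).faces → γ ∈ (filling k Y).faces := fun γ hγ =>
    (hfill γ).mpr (Or.inl hγ)
  have hZ : α ∪ β ∈ (filling k Y).faces := (hfill _).mpr (Or.inr Finset.Subset.rfl)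
  have hZX : α ∪ β ∉ (filling k X).faces :=
    h.notMem_filling_source hβ Finset.subset_union_right
  -- On `α ∪ β` the filling induces the same subcomplex as the sphere, so the new simplex is glued
  -- along boundary faces only.
  have hind : ∀ γ, γ ⊆ α ∪ β → (γ ∈ (filling k X).faces ↔ ¬β ⊆ γ) := fun γ hγ =>
    ⟨fun h' hβγ => h.notMem_filling_source hβ hβγ h', fun h' =>
      faces_subset_filling k X ((h.mem_source_iff hγ).mpr h')⟩
  have hpure : (filling k Y).IsPure (d + 1) := by
    intro γ hγ
    rcases (hfill γ).mp hγ with h' | h'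
    · obtain ⟨h1, σ, h2, h3⟩ := hX.isPure γ h'
      exact ⟨h1, σ, hsub σ h2, h3⟩
    · exact ⟨(Finset.card_le_card h').trans_eq hcardZ, α ∪ β, hZ, h', hcardZ⟩
  have hnew : ∀ ρ, ρ ∉ (filling k X).faces →
      {σ | σ ∈ (filling k X).faces ∧ ρ ⊆ σ ∧ σ.card = d + 1 + 1}.ncard = 0 := by
    intro ρ hρ
    rw [Set.ncard_eq_zero ((filling k X).finite.subset fun _ hσ => hσ.1),
      Set.eq_empty_iff_forall_notMem]
    exact fun σ hσ => hρ ((filling k X).down_closed hσ.1 hσ.2.1)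
  have hmove : IsShellingMove (d + 1) (filling k X) (filling k Y) α β := by
    refine ⟨hpure, hX.isPure, (filling k Y).down_closed hZ Finset.subset_union_left,
      (filling k Y).down_closed hZ Finset.subset_union_right, h.2.1, h.2.2.1, hsub,
      fun σ hσ => ⟨fun hσ' => ?_, ?_⟩, hcardZ, ?_⟩
    · exact Finset.eq_of_subset_of_card_le (((hfill σ).mp hσ'.1).resolve_left hσ'.2) (by omega)
    · rintro rfl
      exact ⟨hZ, hZX⟩
    · ext γ
      rw [mem_joinFaces_simplex_boundary h.2.2.1, Set.mem_ofPred_eq, and_comm]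
      exact and_congr_right fun hγ => hind γ hγ
  refine ⟨fun γ hγ hγd => ?_, hpure, fun ρ hρ hρd => ?_, fun ρ hρ hρd => ?_, ?_, ?_⟩
  · rcases (hfill γ).mp hγ with h' | h'
    · exact h.mem_target (hX.mem_of_card γ h' hγd) (by omega)
    · exact h.mem_target_of_subset h' (by omega)
  · refine (h.ncard_facets_le hd hβ ρ).trans ?_
    by_cases hρX : ρ ∈ (filling k X).faces
    -- An old ridge that gains the new facet lies in `X`, so it was in at most one facet before;
    -- this is why the invariant includes `boundary_ridge`.
    · split_ifs with hρZ
      · have := hX.boundary_ridge ρ ((h.mem_source_iff hρZ).mpr ((hind ρ hρZ).mp hρX)) hρd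
        omega
      · exact hX.ridge ρ hρX hρd
    · rw [hnew ρ hρX]
      split_ifs <;> omega
  · refine (h.ncard_facets_le hd hβ ρ).trans ?_
    rcases h.mem_target_iff.mp hρ with h' | h'
    · rw [if_neg h'.2]
      exact hX.boundary_ridge ρ h'.1 hρd
    -- A ridge of the new simplex omits a single vertex, which lies in `α` since `α` is not
    -- contained in `ρ`. Hence `β ⊆ ρ`, and `ρ` was in no old facet.
    · have hβρ : β ⊆ ρ := by
        intro b hb
        by_contra hbρ
        obtain ⟨a, ha, haρ⟩ := Finset.not_subset.mp h'.2
        have hab : a ≠ b := fun hab => Finset.disjoint_left.mp h.2.2.1 ha (hab ▸ hb)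
        have hsub' : insert a (insert b ρ) ⊆ α ∪ β :=
          Finset.insert_subset (Finset.mem_union_left β ha)
            (Finset.insert_subset (Finset.mem_union_right α hb) h'.1)
        have := Finset.card_le_card hsub'
        rw [Finset.card_insert_of_notMem (by simp [hab, haρ]),
          Finset.card_insert_of_notMem hbρ] at this
        omega
      rw [hnew ρ (h.notMem_filling_source hβ hβρ), if_pos h'.1]
  · let f : (filling k X).dualGraph (d + 1) →g (filling k Y).dualGraph (d + 1) :=
      { toFun := fun σ => ⟨σ.1, hsub σ.1 σ.2.1, σ.2.2⟩
        map_rel' := fun {σ τ} hστ =>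
          ⟨fun he => hστ.1 (Subtype.ext (congrArg (fun x => x.1) he)), hστ.2⟩ }
    obtain ⟨b, hb⟩ := h.2.1
    have hbZ : b ∈ α ∪ β := Finset.mem_union_right α hb
    obtain ⟨-, σ₀, hσ₀, hρσ₀, hσ₀d⟩ := hX.isPure ((α ∪ β).erase b)
      -- Dropping `b ∈ β` from the new facet gives an old ridge; any old facet through it is
      -- adjacent to the new one, which keeps the dual graph connected.
      ((hind _ (Finset.erase_subset b _)).mpr fun hβ' => Finset.notMem_erase b _ (hβ' hb))
    let s₀ : {σ : Finset V // σ ∈ (filling k X).faces ∧ σ.card = d + 1 + 1} := ⟨σ₀, hσ₀, hσ₀d⟩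
    have hne : σ₀ ≠ α ∪ β := fun he => hZX (he ▸ hσ₀)
    have hinter : (σ₀ ∩ (α ∪ β)).card = d + 1 := by
      have h1 : ((α ∪ β).erase b).card ≤ (σ₀ ∩ (α ∪ β)).card :=
        Finset.card_le_card (Finset.subset_inter hρσ₀ (Finset.erase_subset b _))
      rw [Finset.card_erase_of_mem hbZ] at h1
      have h2 : (σ₀ ∩ (α ∪ β)).card < σ₀.card := by
        refine Finset.card_lt_card (Finset.inter_subset_left.ssubset_of_ne fun he => hne ?_)
        exact Finset.eq_of_subset_of_card_le (Finset.inter_eq_left.mp he) (by omega)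
      omega
    have hreach : ∀ τ, ((filling k Y).dualGraph (d + 1)).Reachable (f s₀) τ := by
      rintro ⟨τ, hτ, hτd⟩
      rcases (hfill τ).mp hτ with h' | h'
      · exact (hX.connected.preconnected s₀ ⟨τ, h', hτd⟩).map f
      · have hτZ : τ = α ∪ β := Finset.eq_of_subset_of_card_le h' (by omega)
        subst hτZ
        exact SimpleGraph.Adj.reachable ⟨fun he => hne (congrArg (fun x => x.1) he), hinter⟩
    have : Nonempty {σ : Finset V // σ ∈ (filling k Y).faces ∧ σ.card = d + 1 + 1} := ⟨f s₀⟩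
    exact ⟨fun σ τ => (hreach σ).symm.trans (hreach τ)⟩
  · obtain ⟨X₀, hX₀, hchain⟩ := hX.shelling
    exact ⟨X₀, hX₀, hchain.tail ⟨α, β, hβ, hmove⟩⟩

/-- The filling of a `k`-stellated sphere of dimension at least `2k` is `k`-shelled. -/
theorem IsStellated.isShelled_filling {k d : ℕ} (hd : 2 * k ≤ d) {S : SimplicialComplex V}
    (hS : IsStellated k d S) : IsShelled k (d + 1) (filling k S) := by
  obtain ⟨S₀, hS₀, hmoves⟩ := hS
  have hfill : HasShelledFilling k d S := by
    induction hmoves with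
    | refl => exact hS₀.hasShelledFilling hd
    | tail _ hmove ih =>
      obtain ⟨α, β, hβ, hmove⟩ := hmove
      exact ih.bistellarMove hd hβ hmove
  exact ⟨⟨hfill.isPure, hfill.ridge, hfill.connected⟩, hfill.shelling⟩

end Combinatorics

end StackedSpheres

/-! ### The main theorem. -/

open StackedSpheres
theorem theorem6 {F : Type*} [Field F] {V : Type*} [LinearOrder V] (k d : ℕ) (hd : 2 * k ≤ d)
    (S : StackedSpheres.SimplicialComplex V) (hS : IsStackedSphere F k d S) :
    (IsStackedBall F k (d + 1) (filling k S) ∧ (filling k S).boundary (d + 1) = S) ∧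
    (∀ (F' : Type*) [Field F'] (B : StackedSpheres.SimplicialComplex V),
      IsStackedBall F' k (d + 1) B → B.boundary (d + 1) = S → B = filling k S) ∧
    (IsStellated k d S → IsShelled k (d + 1) (filling k S)) := by
  obtain ⟨-, B, hB, rfl⟩ := hS
  refine ⟨?_, fun F' _ B' hB' hS => hS ▸ hB'.eq_filling hd, fun h => h.isShelled_filling hd⟩
  rw [← hB.eq_filling hd]
  exact ⟨hB, rfl⟩
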